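/- **Setting.** Let $E$ be a finite set and, for $i\in E$, let $F^i:\mathbb R^d\to\mathbb R^d$ be a smooth bounded vector field with flow $\Phi^i=(\Phi^i_t)$. Let $M\subset\mathbb R^d$ be a compact set with $\Phi^i_t(M)\subset M$ for all $t\ge 0$ and $i\in E$. For $x\in M$ let $(\lambda(x,i,j))_{i,j\in E}$ be an irreducible matrix with $\lambda(x,i,j)\ge 0$ for $i\ne j$ and $\lambda(x,i,i)=0$, where each $x\mapsto\lambda(x,i,j)$ is continuous on $M$ (irreducible: any state can be reached from any other one through transitions of positive rate). Fix $\lambda>0$ such that $\sum_{j\neq i}\lambda(x,i,j)<\lambda$ for all $x\in M$, $i\in E$, and put $Q(x,i,j)=\lambda(x,i,j)/\lambda$ for $i\ne j$ and $Q(x,i,i)=1-\sum_{j\ne i}Q(x,i,j)$. Under $\mathbb P_{x,i}$, let $(U_n)_{n\ge1}$ be the interarrival times and $T_n=U_1+\dots+U_n$ ($T_0=0$) the jump times of a Poisson process of intensity $\lambda$, and let $\tilde Z_n=(\tilde X_n,\tilde Y_n)\in M\times E$ be the chain with $\tilde Z_0=(x,i)$ that is defined recursively as follows: $U_{n+1}$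 is exponential with parameter $\lambda$ and independent of $(U_k)_{k\le n}$, $(\tilde Z_k)_{k\le n}$; $\tilde X_{n+1}=\Phi^{\tilde Y_n}_{U_{n+1}}(\tilde X_n)$; and, given $U_{n+1}$ and the past, $\tilde Y_{n+1}=j$ with probability $Q(\tilde X_{n+1},\tilde Y_n,j)$. The continuous time process is $Z_t=(\Phi^{\tilde Y_n}_{t-T_n}(\tilde X_n),\tilde Y_n)$ for $T_n\le t<T_{n+1}$. For $x\in M$ let $\gamma^+(x)=\{\Phi^{i_{n-1}}_{u_n}\circ\dots\circ\Phi^{i_0}_{u_1}(x): n\ge1,\ i_0,\dots,i_{n-1}\in E,\ u_1,\dots,u_n\ge0\}$, and let $\Gamma=\{y\in M:\ y\in\overline{\gamma^+(x)}\text{ for all }x\in M\}$ be the accessible set. **Proposition (returns near $\Gamma$).** Let $p\in\Gamma$ and let $\mathcal U$ be a neighbourhood of $p$ in $M$. 1. (Discrete time.) There exist $m\in\mathbb N$ and $\delta>0$ such that for all $i,j\in E$ and $x\in M$, $$\mathbb P_{x,i}\big(\tilde Z_m\in\mathcal U\times\{j\}\big)\ge\delta.$$ In particular, $\mathbb P_{x,i}\big(\exists\,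 l\in\mathbb N:\ \tilde Z_l\in\mathcal U\times\{j\}\big)=1$ for all $x\in M$ and $i,j\in E$. 2. (Continuous time.) There exist $N\in\mathbb N$, a finite covering $\mathcal O^1,\dots,\mathcal O^N$ of $M$ by (relatively) open sets, times $t_1,\dots,t_N>0$ and $\delta>0$ such that for all $i,j\in E$, all $k\in\{1,\dots,N\}$ and all $x\in\mathcal O^k$, $$\mathbb P_{x,i}\big(Z_{t_k}\in\mathcal U\times\{j\}\big)\ge\delta.$$ -/

import Mathlib

open MeasureTheory ProbabilityTheory Set Topology
open scoped NNReal ENNReal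

noncomputable section

namespace SwitchedFlow

/-- The space `ℝ^d` with its Euclidean norm. -/
abbrev Vec (d : ℕ) := EuclideanSpace ℝ (Fin d)

/-- `γ : ℝ → ℝ^d` is a global solution of the Cauchy problem `γ' = F(γ)`, `γ(0) = x`. -/
def IsSolution {d : ℕ} (F : Vec d → Vec d) (x : Vec d) (γ : ℝ → Vec d) : Prop :=
  γ 0 = x ∧ ∀ t, HasDerivAt γ (F (γ t)) t

open Classical in
/-- The flow `Φ_t(x)` of the vector field `F`. For smooth bounded `F` a global solution exists
(`isSolution_flow`) and is unique (`flow_unique`), so that the `else` branch is never used. -/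
def flow {d : ℕ} (F : Vec d → Vec d) (t : ℝ) (x : Vec d) : Vec d :=
  if h : ∃ γ, IsSolution F x γ then h.choose t else x

section FlowLemmas

theorem dist_le_of_solution {d : ℕ} {F : Vec d → Vec d} {C r : ℝ}
    (hC : ∀ x, ‖F x‖ ≤ C) {γ : ℝ → Vec d} (hr : 0 < r)
    (hγ : ∀ t ∈ Ioo (-r) r, HasDerivAt γ (F (γ t)) t) {t : ℝ} (ht : t ∈ Ioo (-r) r) :
    dist (γ t) (γ 0) ≤ C * |t| := by
  have h := Convex.norm_image_sub_le_of_norm_hasDerivWithin_le (f := γ)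
    (f' := fun s => F (γ s)) (s := Ioo (-r) r) (x := 0) (y := t) (C := C)
    (fun s hs => (hγ s hs).hasDerivWithinAt) (fun s _ => hC _) (convex_Ioo _ _)
    ⟨by linarith, hr⟩ ht
  simpa [dist_eq_norm] using h

theorem eqOn_of_solution {d : ℕ} {F : Vec d → Vec d} (hF : ContDiff ℝ (⊤ : ℕ∞) F) {C r : ℝ}
    (hC : ∀ x, ‖F x‖ ≤ C) {α β : ℝ → Vec d} (hr : 0 < r)
    (hα : ∀ t ∈ Ioo (-r) r, HasDerivAt α (F (α t)) t)
    (hβ : ∀ t ∈ Ioo (-r) r, HasDerivAt β (F (β t)) t) (h0 : α 0 = β 0) :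
    EqOn α β (Ioo (-r) r) := by
  have hC0 : 0 ≤ C := (norm_nonneg _).trans (hC 0)
  obtain ⟨K, hK⟩ := (hF.contDiffOn (s := Metric.closedBall (α 0) (C * r))).exists_lipschitzOnWith
    (by simp) (convex_closedBall _ _) (isCompact_closedBall _ _)
  have key : ∀ {γ : ℝ → Vec d}, (∀ t ∈ Ioo (-r) r, HasDerivAt γ (F (γ t)) t) → γ 0 = α 0 →
      ∀ t ∈ Ioo (-r) r, γ t ∈ Metric.closedBall (α 0) (C * r) := by
    intro γ hγ h t ht
    rw [Metric.mem_closedBall, ← h]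
    refine (dist_le_of_solution hC hr hγ ht).trans ?_
    have : |t| ≤ r := (abs_lt.mpr ⟨ht.1, ht.2⟩).le
    gcongr
  exact ODE_solution_unique_of_mem_Ioo (v := fun _ => F)
    (s := fun _ => Metric.closedBall (α 0) (C * r)) (K := K) (t₀ := 0)
    (fun _ _ => hK) ⟨by linarith, hr⟩
    (fun t ht => ⟨hα t ht, key hα rfl t ht⟩) (fun t ht => ⟨hβ t ht, key hβ h0.symm t ht⟩) h0

theorem exists_solution {d : ℕ} {F : Vec d → Vec d} (hF : ContDiff ℝ (⊤ : ℕ∞) F) {C : ℝ}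
    (hC : ∀ x, ‖F x‖ ≤ C) (x : Vec d) : ∃ γ, IsSolution F x γ := by
  have hC0 : 0 ≤ C := (norm_nonneg _).trans (hC 0)
  have hloc : ∀ n : ℕ, ∃ α : ℝ → Vec d, α 0 = x ∧
      ∀ t ∈ Ioo (-((n : ℝ) + 1)) ((n : ℝ) + 1), HasDerivAt α (F (α t)) t := by
    intro n
    have hn : (0 : ℝ) < (n : ℝ) + 1 := by positivity
    obtain ⟨K, hK⟩ := (hF.contDiffOn
      (s := Metric.closedBall x (C * ((n : ℝ) + 1)))).exists_lipschitzOnWith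
      (by simp) (convex_closedBall _ _) (isCompact_closedBall _ _)
    have hP : IsPicardLindelof (fun _ : ℝ => F) (tmin := -((n : ℝ) + 1)) (tmax := (n : ℝ) + 1)
        ⟨0, by constructor <;> linarith⟩ x ⟨C * ((n : ℝ) + 1), by positivity⟩ 0 ⟨C, hC0⟩ K :=
      IsPicardLindelof.of_time_independent (fun y _ => hC y) hK (by
        simp only [sub_zero, zero_sub, neg_neg, max_self, NNReal.coe_zero]
        exact le_rfl)
    obtain ⟨α, h0, hα⟩ := hP.exists_eq_forall_mem_Icc_hasDerivWithinAt₀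
    exact ⟨α, h0, fun t ht => (hα t (Ioo_subset_Icc_self ht)).hasDerivAt
      (Icc_mem_nhds ht.1 ht.2)⟩
  choose α h0 hα using hloc
  have hagree : ∀ (m n : ℕ) (t : ℝ), |t| < (m : ℝ) + 1 → |t| < (n : ℝ) + 1 →
      α m t = α n t := by
    intro m n t hm hn
    have hr : (0 : ℝ) < min ((m : ℝ) + 1) ((n : ℝ) + 1) := by positivity
    refine eqOn_of_solution hF hC hr (fun s hs => hα m s ?_) (fun s hs => hα n s ?_)
      ((h0 m).trans (h0 n).symm) (abs_lt.mp (lt_min hm hn))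
    · have := min_le_left ((m : ℝ) + 1) ((n : ℝ) + 1)
      exact ⟨by linarith [hs.1], by linarith [hs.2]⟩
    · have := min_le_right ((m : ℝ) + 1) ((n : ℝ) + 1)
      exact ⟨by linarith [hs.1], by linarith [hs.2]⟩
  refine ⟨fun t => α ⌈|t|⌉₊ t, by simpa using h0 _, fun t => ?_⟩
  have hlt : ∀ s : ℝ, |s| < (⌈|s|⌉₊ : ℝ) + 1 := fun s => by
    have := Nat.le_ceil |s|
    linarith
  have hd := hα (⌈|t|⌉₊) t (abs_lt.mp (hlt t))
  refine hd.congr_of_eventuallyEq ?_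
  have hopen : ∀ᶠ s in 𝓝 t, |s| < (⌈|t|⌉₊ : ℝ) + 1 :=
    (continuous_abs.tendsto t).eventually (gt_mem_nhds (hlt t))
  filter_upwards [hopen] with s hs
  exact hagree _ _ s (hlt s) hs

theorem isSolution_flow {d : ℕ} {F : Vec d → Vec d} (hF : ContDiff ℝ (⊤ : ℕ∞) F)
    (hC : ∃ C, ∀ x, ‖F x‖ ≤ C) (x : Vec d) : IsSolution F x (fun t => flow F t x) := by
  obtain ⟨C, hC⟩ := hC
  have h := exists_solution hF hC x
  have e : (fun t => flow F t x) = h.choose := by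
    funext t
    simp only [flow, dif_pos h]
  rw [e]
  exact h.choose_spec

theorem flow_unique {d : ℕ} {F : Vec d → Vec d} (hF : ContDiff ℝ (⊤ : ℕ∞) F)
    (hC : ∃ C, ∀ x, ‖F x‖ ≤ C) {x : Vec d} {γ : ℝ → Vec d} (hγ : IsSolution F x γ) (t : ℝ) :
    γ t = flow F t x := by
  have h := isSolution_flow hF hC x
  obtain ⟨C, hC⟩ := hC
  have ht : t ∈ Ioo (-(|t| + 1)) (|t| + 1) :=
    ⟨by linarith [neg_abs_le t], by linarith [le_abs_self t]⟩
  exact eqOn_of_solution hF hC (by positivity) (fun s _ => hγ.2 s) (fun s _ => h.2 s)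
    (hγ.1.trans h.1.symm) ht

theorem continuous_flow {d : ℕ} {F : Vec d → Vec d} (hF : ContDiff ℝ (⊤ : ℕ∞) F)
    (hC : ∃ C, ∀ x, ‖F x‖ ≤ C) : Continuous fun q : ℝ≥0 × Vec d => flow F q.1 q.2 := by
  have hsol := isSolution_flow hF hC
  obtain ⟨C, hC⟩ := hC
  have hC0 : 0 ≤ C := (norm_nonneg _).trans (hC 0)
  have hball : ∀ (x : Vec d) (t : ℝ), 0 ≤ t → dist (flow F t x) x ≤ C * t := by
    intro x t ht
    have h := dist_le_of_solution hC (r := |t| + 1) (by positivity)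
      (fun s _ => (hsol x).2 s)
      (t := t) ⟨by linarith [neg_abs_le t], by linarith [le_abs_self t]⟩
    have h0 : flow F 0 x = x := (hsol x).1
    rwa [h0, abs_of_nonneg ht] at h
  rw [continuous_iff_continuousAt]
  rintro ⟨t₀, x₀⟩
  obtain ⟨K, hK⟩ := (hF.contDiffOn
    (s := Metric.closedBall x₀ (1 + C * ((t₀ : ℝ) + 1)))).exists_lipschitzOnWith
    (by simp) (convex_closedBall _ _) (isCompact_closedBall _ _)
  have hmem : ∀ x ∈ Metric.closedBall x₀ 1, ∀ t ∈ Icc (0 : ℝ) ((t₀ : ℝ) + 1),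
      flow F t x ∈ Metric.closedBall x₀ (1 + C * ((t₀ : ℝ) + 1)) := by
    intro x hx t ht
    have h1 := hball x t ht.1
    have h2 : C * t ≤ C * ((t₀ : ℝ) + 1) := mul_le_mul_of_nonneg_left ht.2 hC0
    have h3 := dist_triangle (flow F t x) x x₀
    rw [Metric.mem_closedBall] at hx ⊢
    linarith
  have hcont : ∀ x, Continuous fun t => flow F t x := fun x =>
    continuous_iff_continuousAt.mpr fun t => ((hsol x).2 t).continuousAt
  have hlip : ∀ x ∈ Metric.closedBall x₀ 1, ∀ t ∈ Icc (0 : ℝ) ((t₀ : ℝ) + 1),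
      dist (flow F t x) (flow F t x₀) ≤ dist x x₀ * Real.exp (K * ((t₀ : ℝ) + 1)) := by
    intro x hx t ht
    have h := dist_le_of_trajectories_ODE_of_mem (v := fun _ => F) (K := K) (a := 0)
      (b := (t₀ : ℝ) + 1) (s := fun _ => Metric.closedBall x₀ (1 + C * ((t₀ : ℝ) + 1)))
      (f := fun t => flow F t x) (g := fun t => flow F t x₀) (δ := dist x x₀)
      (fun _ _ => hK) (hcont x).continuousOn (fun s _ => ((hsol x).2 s).hasDerivWithinAt)
      (fun s hs => hmem x hx s (Ico_subset_Icc_self hs))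
      (hcont x₀).continuousOn (fun s _ => ((hsol x₀).2 s).hasDerivWithinAt)
      (fun s hs => hmem x₀ (Metric.mem_closedBall_self zero_le_one) s (Ico_subset_Icc_self hs))
      (by
        have h0 : flow F 0 x = x := (hsol x).1
        have h0' : flow F 0 x₀ = x₀ := (hsol x₀).1
        simp only [h0, h0', le_refl]) t ht
    refine h.trans ?_
    gcongr
    linarith [ht.2]
  rw [ContinuousAt, tendsto_iff_dist_tendsto_zero]
  have hb : Filter.Tendsto (fun q : ℝ≥0 × Vec d =>
      dist q.2 x₀ * Real.exp (K * ((t₀ : ℝ) + 1)) + dist (flow F q.1 x₀) (flow F t₀ x₀))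
      (𝓝 (t₀, x₀)) (𝓝 0) := by
    have hc : Continuous (fun q : ℝ≥0 × Vec d =>
        dist q.2 x₀ * Real.exp (K * ((t₀ : ℝ) + 1)) + dist (flow F q.1 x₀) (flow F t₀ x₀)) := by
      have h1 : Continuous (fun q : ℝ≥0 × Vec d => flow F (q.1 : ℝ) x₀) :=
        (hcont x₀).comp (by fun_prop)
      fun_prop
    simpa using hc.tendsto (t₀, x₀)
  refine squeeze_zero' (Filter.Eventually.of_forall fun _ => dist_nonneg) ?_ hb
  have e1 : ∀ᶠ q : ℝ≥0 × Vec d in 𝓝 (t₀, x₀), q.1 < t₀ + 1 :=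
    (continuous_fst.tendsto (t₀, x₀)).eventually (gt_mem_nhds (by simp))
  have e2 : ∀ᶠ q : ℝ≥0 × Vec d in 𝓝 (t₀, x₀), q.2 ∈ Metric.closedBall x₀ 1 :=
    (continuous_snd.tendsto (t₀, x₀)).eventually (Metric.closedBall_mem_nhds _ one_pos)
  filter_upwards [e1, e2] with q h1 h2
  have h1' : (q.1 : ℝ) ≤ (t₀ : ℝ) + 1 := by exact_mod_cast h1.le
  exact (dist_triangle _ (flow F q.1 x₀) _).trans
    (by gcongr; exact hlip q.2 h2 q.1 ⟨q.1.2, h1'⟩)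

end FlowLemmas

/-- The data of the switched process on `M × E`: smooth bounded vector fields `F i` on `ℝ^d`,
a compact set `M` positively invariant under all their flows, jump rates `rate x i j`,
and a dominating rate `lam` for the homogeneous Poisson clock. -/
structure System (d : ℕ) (E : Type*) [Fintype E] where
  F : E → Vec d → Vec d
  smooth : ∀ i, ContDiff ℝ (⊤ : ℕ∞) (F i)
  bounded : ∃ C, ∀ i x, ‖F i x‖ ≤ C
  M : Set (Vec d)
  isCompact : IsCompact M
  invariant : ∀ i, ∀ t : ℝ, 0 ≤ t → ∀ x ∈ M, flow (F i) t x ∈ M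
  rate : M → E → E → ℝ
  rate_continuous : ∀ i j, Continuous fun x => rate x i j
  rate_nonneg : ∀ x i j, i ≠ j → 0 ≤ rate x i j
  rate_diag : ∀ x i, rate x i i = 0
  /-- Each matrix `rate x` is irreducible: any state can be reached from any other one through
  finitely many transitions of positive rate. -/
  irreducible : ∀ x i j, Relation.ReflTransGen (fun a b => 0 < rate x a b) i j
  lam : ℝ
  lam_pos : 0 < lam
  sum_rate_lt : ∀ x i, ∑ j, rate x i j < lam

namespace System

variable {d : ℕ} {E : Type*} [Fintype E] (S : System d E)

/-- The flow `Φ^i_t`, `t ≥ 0`, on the positively invariant set `M`. -/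
def Phi (i : E) (t : ℝ≥0) (x : S.M) : S.M :=
  ⟨flow (S.F i) t x, S.invariant i t t.2 x x.2⟩

theorem continuous_Phi (i : E) : Continuous fun q : ℝ≥0 × S.M => S.Phi i q.1 q.2 := by
  refine Continuous.subtype_mk ?_ _
  have hC : ∃ C, ∀ x, ‖S.F i x‖ ≤ C := S.bounded.imp fun _ h => h i
  exact (continuous_flow (S.smooth i) hC).comp
    (f := fun q : ℝ≥0 × S.M => ((q.1, (q.2 : Vec d)) : ℝ≥0 × Vec d)) (by fun_prop)

open Classical in
/-- The transition matrix `Q(x)`: `Q(x,i,j) = rate(x,i,j)/lam` for `i ≠ j`, and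
`Q(x,i,i) = 1 - ∑_{j ≠ i} Q(x,i,j)`. -/
def Q (x : S.M) (i j : E) : ℝ :=
  if i = j then 1 - ∑ k ∈ Finset.univ.erase i, S.rate x i k / S.lam else S.rate x i j / S.lam

theorem Q_nonneg (x : S.M) (i j : E) : 0 ≤ S.Q x i j := by
  classical
  have hl := S.lam_pos
  unfold Q
  split_ifs with h
  · rw [← Finset.sum_div, sub_nonneg, div_le_one hl,
      Finset.sum_erase _ (S.rate_diag x i)]
    exact (S.sum_rate_lt x i).le
  · exact div_nonneg (S.rate_nonneg x i j h) hl.le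

theorem sum_Q (x : S.M) (i : E) : ∑ j, S.Q x i j = 1 := by
  classical
  rw [← Finset.add_sum_erase _ _ (Finset.mem_univ i)]
  have h : ∑ j ∈ Finset.univ.erase i, S.Q x i j =
      ∑ j ∈ Finset.univ.erase i, S.rate x i j / S.lam :=
    Finset.sum_congr rfl fun j hj => by
      unfold Q
      rw [if_neg (Finset.ne_of_mem_erase hj).symm]
  rw [h]
  unfold Q
  simp

theorem continuous_Q (i j : E) : Continuous fun x => S.Q x i j := by
  classical
  have := S.rate_continuous
  unfold Q
  split_ifs <;> fun_prop

/-- The composite flow: `x_0 = x` and `x_{k+1} = Φ^{i_k}_{u_{k+1}}(x_k)`. -/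
def compositeFlow (i : ℕ → E) (u : ℕ → ℝ≥0) (x : S.M) : ℕ → S.M
  | 0 => x
  | k + 1 => S.Phi (i k) (u (k + 1)) (compositeFlow i u x k)

/-- The positive orbit `γ⁺(x)`: all points that can be reached from `x` by following `n ≥ 1`
of the flows successively (only `i_0, …, i_{n-1}` and `u_1, …, u_n` matter). -/
def positiveOrbit (x : S.M) : Set S.M :=
  {y | ∃ n : ℕ, 1 ≤ n ∧ ∃ (i : ℕ → E) (u : ℕ → ℝ≥0), y = S.compositeFlow i u x n}

/-- The accessible set `Γ = ⋂_{x ∈ M} closure (γ⁺(x))`, as a subset of `M`. -/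
def accessibleSet : Set S.M := ⋂ x : S.M, closure (S.positiveOrbit x)

/-- The exponential law of parameter `lam`, as a probability measure on `[0,∞)`. -/
def waitingLaw : Measure ℝ≥0 := (expMeasure S.lam).map Real.toNNReal

instance : IsProbabilityMeasure S.waitingLaw :=
  have := isProbabilityMeasure_expMeasure S.lam_pos
  Measure.isProbabilityMeasure_map (by fun_prop)

/-- The canonical space of the construction: a point `ω` lists the pairs
`ω n = (U_n, Z̃_n)` of the interarrival times and of the states of the embedded chain
(the entry `U_0` is set to `0` and plays no role). -/
abbrev Path := ℕ → ℝ≥0 × (S.M × E)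

/-- The embedded chain `Z̃_n = (X̃_n, Ỹ_n)`. -/
def chain (n : ℕ) (ω : S.Path) : S.M × E := (ω n).2

/-- The jump times `T_n = U_1 + ⋯ + U_n` of the Poisson clock. -/
def jumpTime (n : ℕ) (ω : S.Path) : ℝ≥0 := ∑ k ∈ Finset.range n, (ω (k + 1)).1

/-- The number `N_t` of jump times in `(0,t]`, i.e. the largest `n` such that `T_n ≤ t`
(the junk value `0` is used on the null event that there is no largest one). -/
def count (t : ℝ≥0) (ω : S.Path) : ℕ := sSup {n | S.jumpTime n ω ≤ t}

/-- The continuous time process `Z_t = (Φ^{Ỹ_n}(t - T_n, X̃_n), Ỹ_n)` for `T_n ≤ t < T_{n+1}`. -/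
def process (t : ℝ≥0) (ω : S.Path) : S.M × E :=
  let n := S.count t ω
  (S.Phi (S.chain n ω).2 (t - S.jumpTime n ω) (S.chain n ω).1, (S.chain n ω).2)

theorem process_eq {t : ℝ≥0} {ω : S.Path} {n : ℕ} (h₁ : S.jumpTime n ω ≤ t)
    (h₂ : t < S.jumpTime (n + 1) ω) :
    S.process t ω =
      (S.Phi (S.chain n ω).2 (t - S.jumpTime n ω) (S.chain n ω).1, (S.chain n ω).2) := by
  have hmono : Monotone fun n => S.jumpTime n ω := fun a b hab =>
    Finset.sum_le_sum_of_subset (Finset.range_mono hab)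
  have hcount : S.count t ω = n := by
    refine IsGreatest.csSup_eq ⟨h₁, fun m hm => ?_⟩
    by_contra! hlt
    exact absurd ((hmono (Nat.succ_le_of_lt hlt)).trans hm) (not_le.mpr h₂)
  simp only [process, hcount]

variable [MeasurableSpace E] [MeasurableSingletonClass E]

/-- Given the current state `(x,i)` and the waiting time `u`, the law of `(u, (x', j))`:
`x' = Φ^i_u(x)`, and `j` is drawn from `Q(x',i,·)`. -/
def jumpMeasure (q : (S.M × E) × ℝ≥0) : Measure (ℝ≥0 × (S.M × E)) :=
  ∑ j, ENNReal.ofReal (S.Q (S.Phi q.1.2 q.2 q.1.1) q.1.2 j) •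
    Measure.dirac (q.2, (S.Phi q.1.2 q.2 q.1.1, j))

theorem measurable_jumpMeasure : Measurable S.jumpMeasure := by
  have hE : Measurable (fun q : (S.M × E) × ℝ≥0 => S.Phi q.1.2 q.2 q.1.1) := by
    have h : Measurable (fun r : E × (ℝ≥0 × S.M) => S.Phi r.1 r.2.1 r.2.2) :=
      measurable_from_prod_countable_right fun i => (S.continuous_Phi i).measurable
    exact h.comp (g := fun r : E × (ℝ≥0 × S.M) => S.Phi r.1 r.2.1 r.2.2)
      (f := fun q : (S.M × E) × ℝ≥0 => (q.1.2, (q.2, q.1.1))) (by fun_prop)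
  have hQ : ∀ j, Measurable (fun q : (S.M × E) × ℝ≥0 =>
      S.Q (S.Phi q.1.2 q.2 q.1.1) q.1.2 j) := fun j => by
    have h : Measurable (fun r : E × S.M => S.Q r.2 r.1 j) :=
      measurable_from_prod_countable_right fun i => (S.continuous_Q i j).measurable
    exact h.comp (g := fun r : E × S.M => S.Q r.2 r.1 j)
      (f := fun q : (S.M × E) × ℝ≥0 => (q.1.2, S.Phi q.1.2 q.2 q.1.1)) (by fun_prop)
  refine Measure.measurable_of_measurable_coe _ fun A hA => ?_
  simp only [jumpMeasure, Measure.finsetSum_apply, Measure.smul_apply, smul_eq_mul]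
  refine Finset.measurable_sum _ fun j _ => Measurable.mul ?_ ?_
  · exact (hQ j).ennreal_ofReal
  · simp only [Measure.dirac_apply' _ hA]
    exact (measurable_one.indicator hA).comp
      (f := fun q : (S.M × E) × ℝ≥0 => (q.2, (S.Phi q.1.2 q.2 q.1.1, j))) (by fun_prop)

/-- `jumpMeasure` as a Markov kernel. -/
def jumpKernel : Kernel ((S.M × E) × ℝ≥0) (ℝ≥0 × (S.M × E)) :=
  ⟨S.jumpMeasure, S.measurable_jumpMeasure⟩

instance : IsMarkovKernel S.jumpKernel := ⟨fun q => ⟨by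
  change S.jumpMeasure q univ = 1
  simp only [jumpMeasure, Measure.finsetSum_apply, Measure.smul_apply, smul_eq_mul,
    measure_univ, mul_one]
  rw [← ENNReal.ofReal_sum_of_nonneg fun j _ => S.Q_nonneg _ _ _, S.sum_Q, ENNReal.ofReal_one]⟩⟩

/-- One step of the embedded chain, together with its waiting time: from `(x,i)`, draw `U` from
the exponential law of parameter `lam`, set `X' = Φ^i_U(x)`, draw `Y'` from `Q(X',i,·)`;
the kernel gives the law of `(U, (X', Y'))`. -/
def stepKernel : Kernel (S.M × E) (ℝ≥0 × (S.M × E)) :=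
  S.jumpKernel ∘ₖ (Kernel.id ×ₖ Kernel.const _ S.waitingLaw)

instance : IsMarkovKernel S.stepKernel := by
  unfold stepKernel
  infer_instance

theorem stepKernel_apply (z : S.M × E) {A : Set (ℝ≥0 × (S.M × E))} (hA : MeasurableSet A) :
    S.stepKernel z A = ∫⁻ u, ∑ j, ENNReal.ofReal (S.Q (S.Phi z.2 u z.1) z.2 j) *
      A.indicator 1 (u, (S.Phi z.2 u z.1, j)) ∂S.waitingLaw := by
  rw [stepKernel, Kernel.comp_apply' _ _ _ hA, Kernel.prod_apply, Kernel.id_apply,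
    Kernel.const_apply, Measure.dirac_prod, lintegral_map (Kernel.measurable_coe _ hA)
    (by fun_prop)]
  refine lintegral_congr fun u => ?_
  change S.jumpMeasure (z, u) A = _
  simp only [jumpMeasure, Measure.finsetSum_apply, Measure.smul_apply, smul_eq_mul,
    Measure.dirac_apply' _ hA]

/-- The step kernel as a function of the history up to time `n`. -/
def historyKernel (n : ℕ) :
    Kernel ((k : Finset.Iic n) → ℝ≥0 × (S.M × E)) (ℝ≥0 × (S.M × E)) :=
  S.stepKernel.comap (fun h => (h ⟨n, Finset.mem_Iic.mpr le_rfl⟩).2) (by fun_prop)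

instance (n : ℕ) : IsMarkovKernel (S.historyKernel n) := by
  unfold historyKernel
  infer_instance

/-- The probability `P_{x,i}` on the canonical space: the Markov chain with transitions
`stepKernel`, started at `Z̃_0 = (x,i)`. -/
def prob (x : S.M) (i : E) : Measure S.Path :=
  Kernel.trajMeasure (X := fun _ => ℝ≥0 × (S.M × E))
    (Measure.dirac ((0 : ℝ≥0), (x, i))) S.historyKernel

instance (x : S.M) (i : E) : IsProbabilityMeasure (S.prob x i) := by
  unfold prob
  infer_instance

end System

end SwitchedFlow

end

/-!
Let `P` be the transition operator of the Markov chain `(T_n, Z̃_n)`. It maps lower semicontinuous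
functions to lower semicontinuous functions (Fatou). Since the exponential law charges every
nonempty open subset of `[0, ∞)`, the mean `P h` of a lower semicontinuous `h ≥ 0` is positive at a
state as soon as `h` is positive at *one* state that can follow it. In particular the mode can
be changed along a positive rate at elapsed time `0`, and a flow can be followed without changing
the mode because `Q(x, i, i) > 0`. As `p` is accessible, from every starting point the chain reaches
`V × {j}`, where `V` is open and contains `p`, with positive probability in some number of steps.

`Q(x, i, i) > 0` also shows that the set of starting points from which `V × {j}` has positive
probability at step `n` increases with `n`, so that by compactness one `m` serves all of them, and
lower semicontinuity bounds the probability below. By the Markov property, `V × {j}` is then missed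
`k` times in a row with probability at most `(1 - ε)^k`.

In continuous time the chain `(T_n, Z̃_n)` is led into the open set of pairs `(s, z)`, `s < t`, such
that the flow from `z` is in `V` after the remaining time `t - s`. The next waiting time is
independent of the past and exceeds `t` with positive probability; on that event `Z_t ∈ V × {j}`.
-/

namespace SwitchedFlow

section LowerSemicontinuity

variable {X Y : Type*} [TopologicalSpace X]

theorem lowerSemicontinuous_ennreal_mul {f g : X → ℝ≥0∞} (hf : LowerSemicontinuous f)
    (hg : LowerSemicontinuous g) : LowerSemicontinuous fun x => f x * g x :=
  lowerSemicontinuous_iff_le_liminf.mpr fun x =>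
    (mul_le_mul' (hf.le_liminf x) (hg.le_liminf x)).trans ENNReal.le_liminf_mul

theorem lowerSemicontinuous_prod_of_discrete_left {ι β : Type*} [TopologicalSpace ι]
    [DiscreteTopology ι] [Preorder β] {f : ι × X → β}
    (hf : ∀ a, LowerSemicontinuous fun x => f (a, x)) : LowerSemicontinuous f := by
  rintro ⟨a, x⟩ b hb
  rw [nhds_prod_eq, nhds_discrete, Filter.pure_prod, Filter.eventually_map]
  exact hf a x b hb

theorem lowerSemicontinuous_lintegral [FirstCountableTopology X] [MeasurableSpace Y]
    (μ : Measure Y) {g : X → Y → ℝ≥0∞} (hlsc : ∀ y, LowerSemicontinuous fun x => g x y)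
    (hmeas : ∀ x, Measurable (g x)) : LowerSemicontinuous fun x => ∫⁻ y, g x y ∂μ :=
  lowerSemicontinuous_iff_le_liminf.mpr fun x =>
    (lintegral_mono fun y => (hlsc y).le_liminf x).trans (lintegral_liminf_le hmeas)

theorem lintegral_pos_of_lowerSemicontinuous [MeasurableSpace X] [OpensMeasurableSpace X]
    (μ : Measure X) [μ.IsOpenPosMeasure] {f : X → ℝ≥0∞} (hf : LowerSemicontinuous f) {x : X}
    (hx : 0 < f x) : 0 < ∫⁻ y, f y ∂μ := by
  rw [lintegral_pos_iff_support hf.measurable]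
  exact ((hf.isOpen_preimage 0).measure_pos μ ⟨x, hx⟩).trans_le
    (measure_mono fun _ hy => (mem_Ioi.mp hy).ne')

theorem exists_pos_forall_lt_of_lowerSemicontinuous [CompactSpace X] {f : X → ℝ≥0∞}
    (hf : LowerSemicontinuous f) (hpos : ∀ x, 0 < f x) : ∃ ε : ℝ≥0, 0 < ε ∧ ∀ x, ε < f x := by
  cases isEmpty_or_nonempty X
  · exact ⟨1, one_pos, isEmptyElim⟩
  · obtain ⟨a, -, ha⟩ :=
      (hf.lowerSemicontinuousOn univ).exists_isMinOn univ_nonempty isCompact_univ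
    obtain ⟨ε, hε, hεa⟩ := ENNReal.lt_iff_exists_nnreal_btwn.mp (hpos a)
    exact ⟨ε, ENNReal.coe_pos.mp hε, fun x => hεa.trans_le (ha (mem_univ x))⟩

theorem exists_forall_pos_of_monotone_support [CompactSpace X] {f : ℕ → X → ℝ≥0∞}
    (hf : ∀ n, LowerSemicontinuous (f n)) (hmono : Monotone fun n => Function.support (f n))
    (hpos : ∀ x, ∃ n, 0 < f n x) : ∃ n, ∀ x, 0 < f n x := by
  have hsupp : ∀ n, Function.support (f n) = f n ⁻¹' Ioi 0 := fun n => by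
    ext x
    exact pos_iff_ne_zero.symm
  obtain ⟨n, hn⟩ := isCompact_univ.elim_directed_cover (fun n => Function.support (f n))
    (fun n => hsupp n ▸ (hf n).isOpen_preimage 0)
    (fun x _ => mem_iUnion.mpr ((hpos x).imp fun _ h => h.ne')) hmono.directed_le
  exact ⟨n, fun x => pos_iff_ne_zero.mpr (hn (mem_univ x))⟩

end LowerSemicontinuity

theorem exists_fin_iUnion_interior_eq_univ {X : Type*} [TopologicalSpace X] [CompactSpace X]
    (U : X → Set X) (hU : ∀ x, U x ∈ 𝓝 x) :
    ∃ (N : ℕ) (c : Fin N → X), ⋃ k, interior (U (c k)) = univ := by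
  obtain ⟨s, -, hs⟩ := isCompact_univ.elim_nhds_subcover (fun x => interior (U x))
    fun x _ => interior_mem_nhds.mpr (hU x)
  refine ⟨s.card, fun k => s.equivFin.symm k, eq_univ_of_forall fun x => ?_⟩
  obtain ⟨y, hy, hxy⟩ := mem_iUnion₂.mp (hs (mem_univ x))
  exact mem_iUnion.mpr ⟨s.equivFin ⟨y, hy⟩, by simpa using hxy⟩

theorem measure_iInter_eq_zero_of_le_mul {Ω : Type*} [MeasurableSpace Ω] {μ : Measure Ω}
    {A : ℕ → Set Ω} {c : ℝ≥0∞} (hA₀ : μ (A 0) ≠ ∞) (hc : c < 1)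
    (hA : ∀ k, μ (A (k + 1)) ≤ c * μ (A k)) : μ (⋂ k, A k) = 0 := by
  have hgeom : ∀ k, μ (⋂ k, A k) ≤ c ^ k * μ (A 0) := fun k =>
    (measure_mono (iInter_subset A k)).trans <| by
      induction k with
      | zero => simp only [pow_zero, one_mul, le_refl]
      | succ k ih => exact (hA k).trans (by rw [pow_succ', mul_assoc]; gcongr)
  have hlim : Filter.Tendsto (fun k => c ^ k * μ (A 0)) Filter.atTop (𝓝 0) := by
    simpa only [zero_mul] using ENNReal.Tendsto.mul_const
      (ENNReal.tendsto_pow_atTop_nhds_zero_of_lt_one hc) (Or.inr hA₀)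
  exact le_antisymm (ge_of_tendsto' hlim hgeom) zero_le

theorem volume_restrict_Ioi_absolutelyContinuous_expMeasure {r : ℝ} (hr : 0 < r) :
    volume.restrict (Ioi 0) ≪ expMeasure r := by
  have h : volume.restrict (Ioi 0) ≪
      (volume.restrict (Ioi 0)).withDensity (exponentialPDF r) :=
    withDensity_absolutelyContinuous' (measurable_exponentialPDFReal r).ennreal_ofReal.aemeasurable
      (ae_restrict_of_forall_mem measurableSet_Ioi fun _ hx =>
        (ENNReal.ofReal_pos.mpr (exponentialPDFReal_pos hr hx)).ne')
  rw [← restrict_withDensity measurableSet_Ioi] at h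
  exact h.trans Measure.restrict_le_self.absolutelyContinuous

section Trajectories

open Preorder

variable {X : ℕ → Type*} [∀ n, MeasurableSpace (X n)] {μ₀ : Measure (X 0)}
  {κ : (n : ℕ) → Kernel ((k : Finset.Iic n) → X k) (X (n + 1))}
  [∀ n, IsMarkovKernel (κ n)]

theorem map_eval_zero_trajMeasure : (Kernel.trajMeasure μ₀ κ).map (fun ω => ω 0) = μ₀ := by
  have hmap : (Kernel.trajMeasure μ₀ κ).map (frestrictLe 0) =
      μ₀.map (MeasurableEquiv.piUnique fun k : Finset.Iic 0 => X k).symm := by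
    rw [Kernel.trajMeasure, Measure.map_comp _ _ (by fun_prop), Kernel.traj_map_frestrictLe,
      Kernel.partialTraj_self, Measure.id_comp]
    rfl
  have heval : Measurable fun h : (k : Finset.Iic 0) → X k => h ⟨0, Finset.mem_Iic.mpr le_rfl⟩ :=
    measurable_pi_apply _
  have hcomp := Measure.map_map heval (measurable_frestrictLe 0) (μ := Kernel.trajMeasure μ₀ κ)
  rw [hmap] at hcomp
  exact hcomp.symm.trans
    ((Measure.map_map heval (MeasurableEquiv.measurable _)).trans Measure.map_id)

theorem setLIntegral_trajMeasure_succ [IsProbabilityMeasure μ₀] {n : ℕ} {A : Set ((k : ℕ) → X k)}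
    (hA : MeasurableSet[Filtration.piLE n] A)
    {F : ((k : Finset.Iic n) → X k) × X (n + 1) → ℝ≥0∞} (hF : Measurable F) :
    ∫⁻ ω in A, F (frestrictLe n ω, ω (n + 1)) ∂Kernel.trajMeasure μ₀ κ =
      ∫⁻ ω in A, ∫⁻ w, F (frestrictLe n ω, w) ∂κ n (frestrictLe n ω)
        ∂Kernel.trajMeasure μ₀ κ := by
  rw [Filtration.piLE_eq_comap_frestrictLe] at hA
  obtain ⟨B, hB, rfl⟩ := hA
  have h := congrArg (fun ν => ∫⁻ p in B ×ˢ univ, F p ∂ν)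
    (Kernel.map_frestrictLe_trajMeasure_compProd_eq_map_trajMeasure
      (μ₀ := μ₀) (κ := κ) (a := n))
  rw [Measure.setLIntegral_compProd hF hB .univ,
    setLIntegral_map (hB.prod .univ) hF (by fun_prop)] at h
  simp only [Measure.restrict_univ] at h
  rw [setLIntegral_map hB hF.lintegral_kernel_prod_right' (by fun_prop)] at h
  rw [mk_preimage_prod, preimage_univ, inter_univ] at h
  exact h.symm

end Trajectories

namespace System

variable {d : ℕ} {E : Type*} [Fintype E] (S : System d E)

instance : CompactSpace S.M := isCompact_iff_compactSpace.mp S.isCompact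

instance : S.waitingLaw.IsOpenPosMeasure := ⟨by
  rintro V hV ⟨u, hu⟩
  have hW : IsOpen (Real.toNNReal ⁻¹' V) := hV.preimage continuous_real_toNNReal
  have hright : ∀ᶠ v in 𝓝[>] u, v ∈ V ∩ Ioi u :=
    Filter.inter_mem (mem_nhdsWithin_of_mem_nhds (hV.mem_nhds hu)) self_mem_nhdsWithin
  obtain ⟨v, hv, huv⟩ := hright.exists
  have hv0 : (0 : ℝ) < v := NNReal.coe_pos.mpr (pos_of_gt huv)
  have hvol : volume (Real.toNNReal ⁻¹' V ∩ Ioi 0) ≠ 0 :=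
    ((hW.inter isOpen_Ioi).measure_pos volume ⟨v, by simpa using hv, hv0⟩).ne'
  rw [waitingLaw, Measure.map_apply (by fun_prop) hV.measurableSet]
  rw [← Measure.restrict_apply hW.measurableSet] at hvol
  exact mt (fun h => volume_restrict_Ioi_absolutelyContinuous_expMeasure S.lam_pos h) hvol⟩

theorem Phi_zero (i : E) (x : S.M) : S.Phi i 0 x = x :=
  Subtype.ext (isSolution_flow (S.smooth i) (S.bounded.imp fun _ h => h i) (x : Vec d)).1

theorem Q_self_pos (x : S.M) (i : E) : 0 < S.Q x i i := by
  classical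
  rw [Q, if_pos rfl, ← Finset.sum_div, sub_pos, div_lt_one S.lam_pos,
    Finset.sum_erase _ (S.rate_diag x i)]
  exact S.sum_rate_lt x i

theorem Q_pos_of_rate_pos {x : S.M} {i j : E} (h : 0 < S.rate x i j) : 0 < S.Q x i j := by
  have hij : i ≠ j := fun hij => h.ne' (hij ▸ S.rate_diag x i)
  rw [Q, if_neg hij]
  exact div_pos h S.lam_pos

theorem exists_compositeFlow_mem {p : S.M} (hp : p ∈ S.accessibleSet) {V : Set S.M}
    (hV : IsOpen V) (hpV : p ∈ V) (x : S.M) :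
    ∃ (n : ℕ) (i : ℕ → E) (u : ℕ → ℝ≥0), S.compositeFlow i u x n ∈ V := by
  obtain ⟨_, hy, n, _, i, u, rfl⟩ := mem_closure_iff.mp (mem_iInter.mp hp x) V hV hpV
  exact ⟨n, i, u, hy⟩

theorem jumpTime_succ (n : ℕ) (ω : S.Path) :
    S.jumpTime (n + 1) ω = S.jumpTime n ω + (ω (n + 1)).1 :=
  Finset.sum_range_succ _ _

/-- The time-space chain `(T_n, Z̃_n)`. -/
def timedChain (n : ℕ) (ω : S.Path) : ℝ≥0 × (S.M × E) := (S.jumpTime n ω, S.chain n ω)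

/-- `timedChain n` as a function of the history up to time `n`. -/
def historyTimedChain (n : ℕ) (h : (k : Finset.Iic n) → ℝ≥0 × (S.M × E)) : ℝ≥0 × (S.M × E) :=
  (∑ k : Finset.range n, (h ⟨k + 1, Finset.mem_Iic.mpr (Finset.mem_range.mp k.2)⟩).1,
    (h ⟨n, Finset.mem_Iic.mpr le_rfl⟩).2)

theorem historyTimedChain_frestrictLe (n : ℕ) (ω : S.Path) :
    S.historyTimedChain n (Preorder.frestrictLe n ω) = S.timedChain n ω :=
  Prod.ext (Finset.sum_coe_sort (Finset.range n) fun k => (ω (k + 1)).1) rfl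

/-- The pairs `(s, (y, i))`, `s < t`, of a time and a state from which the flow of mode `i` alone
leads into `B ⊆ M × E` at time `t`. -/
def flowInto (t : ℝ≥0) (B : Set (S.M × E)) : Set (ℝ≥0 × (S.M × E)) :=
  {q | q.1 < t ∧ (S.Phi q.2.2 (t - q.1) q.2.1, q.2.2) ∈ B}

theorem process_mem_of_timedChain_mem_flowInto {t : ℝ≥0} {B : Set (S.M × E)} {n : ℕ} {ω : S.Path}
    (hω : S.timedChain n ω ∈ S.flowInto t B) (ht : t < (ω (n + 1)).1) : S.process t ω ∈ B := by
  rw [S.process_eq hω.1.le (by rw [jumpTime_succ]; exact ht.trans_le le_add_self)]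
  exact hω.2

/-- The mean of `h` at the next value of `timedChain`, from the time and state `q` and given that
the waiting time is `u`. -/
noncomputable def jumpMean (h : ℝ≥0 × (S.M × E) → ℝ≥0∞) (q : ℝ≥0 × (S.M × E)) (u : ℝ≥0) : ℝ≥0∞ :=
  ∑ k, ENNReal.ofReal (S.Q (S.Phi q.2.2 u q.2.1) q.2.2 k) *
    h (q.1 + u, (S.Phi q.2.2 u q.2.1, k))

variable {S} in
theorem jumpMean_pos {h : ℝ≥0 × (S.M × E) → ℝ≥0∞} {s u : ℝ≥0} {y : S.M} {i k : E}
    (hQ : 0 < S.Q (S.Phi i u y) i k) (hh : 0 < h (s + u, (S.Phi i u y, k))) :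
    0 < S.jumpMean h (s, (y, i)) u :=
  Finset.sum_pos_iff.mpr
    ⟨k, Finset.mem_univ k, ENNReal.mul_pos (ENNReal.ofReal_pos.mpr hQ).ne' hh.ne'⟩

section Topology

variable [TopologicalSpace E] [DiscreteTopology E]

theorem continuous_Phi_uncurry :
    Continuous fun r : E × (ℝ≥0 × S.M) => S.Phi r.1 r.2.1 r.2.2 :=
  continuous_prod_of_discrete_left.mpr S.continuous_Phi

theorem continuous_Q_uncurry (j : E) : Continuous fun r : S.M × E => S.Q r.1 r.2 j :=
  continuous_prod_of_discrete_right.mpr fun i => S.continuous_Q i j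

theorem isOpen_flowInto (t : ℝ≥0) {B : Set (S.M × E)} (hB : IsOpen B) :
    IsOpen (S.flowInto t B) := by
  have hΦ : Continuous fun q : ℝ≥0 × (S.M × E) => S.Phi q.2.2 (t - q.1) q.2.1 :=
    S.continuous_Phi_uncurry.comp
      (f := fun q : ℝ≥0 × (S.M × E) => (q.2.2, (t - q.1, q.2.1))) (by fun_prop)
  exact (isOpen_lt continuous_fst continuous_const).inter (hB.preimage (by fun_prop))

variable {S} in
theorem lowerSemicontinuous_jumpMean {h : ℝ≥0 × (S.M × E) → ℝ≥0∞} (hh : LowerSemicontinuous h) :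
    LowerSemicontinuous fun r : (ℝ≥0 × (S.M × E)) × ℝ≥0 => S.jumpMean h r.1 r.2 := by
  have hΦ : Continuous fun r : (ℝ≥0 × (S.M × E)) × ℝ≥0 => S.Phi r.1.2.2 r.2 r.1.2.1 :=
    S.continuous_Phi_uncurry.comp
      (f := fun r : (ℝ≥0 × (S.M × E)) × ℝ≥0 => (r.1.2.2, (r.2, r.1.2.1))) (by fun_prop)
  refine lowerSemicontinuous_sum fun k _ => lowerSemicontinuous_ennreal_mul ?_ ?_
  · have hQ : Continuous fun r : (ℝ≥0 × (S.M × E)) × ℝ≥0 =>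
        S.Q (S.Phi r.1.2.2 r.2 r.1.2.1) r.1.2.2 k :=
      (S.continuous_Q_uncurry k).comp (hΦ.prodMk (by fun_prop))
    exact (ENNReal.continuous_ofReal.comp hQ).lowerSemicontinuous
  · exact hh.comp (g := fun r : (ℝ≥0 × (S.M × E)) × ℝ≥0 =>
      (r.1.1 + r.2, (S.Phi r.1.2.2 r.2 r.1.2.1, k))) (by fun_prop)

end Topology

section Measurability

variable [MeasurableSpace E]

theorem measurable_chain_piLE (n : ℕ) :
    Measurable[Filtration.piLE (X := fun _ => ℝ≥0 × (S.M × E)) n] (S.chain n) := by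
  rw [Filtration.piLE_eq_comap_frestrictLe]
  have h : Measurable fun h : (k : Finset.Iic n) → ℝ≥0 × (S.M × E) =>
      (h ⟨n, Finset.mem_Iic.mpr le_rfl⟩).2 := by fun_prop
  exact h.comp (comap_measurable (Preorder.frestrictLe (π := fun _ => ℝ≥0 × (S.M × E)) n))

theorem measurable_historyTimedChain (n : ℕ) : Measurable (S.historyTimedChain n) := by
  unfold historyTimedChain
  fun_prop

theorem measurable_timedChain_piLE (n : ℕ) :
    Measurable[Filtration.piLE (X := fun _ => ℝ≥0 × (S.M × E)) n] (S.timedChain n) := by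
  rw [Filtration.piLE_eq_comap_frestrictLe,
    ← (funext (S.historyTimedChain_frestrictLe n) :
      S.historyTimedChain n ∘ Preorder.frestrictLe n = S.timedChain n)]
  exact (S.measurable_historyTimedChain n).comp (comap_measurable _)

theorem measurableSet_piLE_forall_le_chain_notMem {B : Set (S.M × E)} (hB : MeasurableSet B)
    (n : ℕ) : MeasurableSet[Filtration.piLE (X := fun _ => ℝ≥0 × (S.M × E)) n]
      {ω | ∀ l ≤ n, S.chain l ω ∉ B} := by
  simp only [ofPred_forall]
  exact MeasurableSet.iInter fun l => MeasurableSet.iInter fun hl =>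
    Filtration.piLE.mono hl _ (S.measurable_chain_piLE l hB.compl)

end Measurability

section TransitionOperator

variable [MeasurableSpace E] [MeasurableSingletonClass E]

/-- The transition operator of the time-space chain `timedChain`. -/
noncomputable def timedStep (h : ℝ≥0 × (S.M × E) → ℝ≥0∞) (q : ℝ≥0 × (S.M × E)) : ℝ≥0∞ :=
  ∫⁻ w, h (q.1 + w.1, w.2) ∂S.stepKernel q.2

/-- The probability that the time-space chain started at `q` is in `G` after `n` steps. -/
noncomputable def transitionProb (n : ℕ) (G : Set (ℝ≥0 × (S.M × E))) (q : ℝ≥0 × (S.M × E)) :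
    ℝ≥0∞ :=
  S.timedStep^[n] (G.indicator 1) q

/-- The time-space chain started at `q` is in `G` with positive probability after some number of
steps. -/
def CanReach (G : Set (ℝ≥0 × (S.M × E))) (q : ℝ≥0 × (S.M × E)) : Prop :=
  ∃ n, 0 < S.transitionProb n G q

variable {S} {h : ℝ≥0 × (S.M × E) → ℝ≥0∞} {G : Set (ℝ≥0 × (S.M × E))} {B : Set (S.M × E)}

theorem transitionProb_succ (n : ℕ) :
    S.transitionProb (n + 1) G = S.timedStep (S.transitionProb n G) :=
  Function.iterate_succ_apply' _ _ _

theorem measurable_timedStep (hh : Measurable h) : Measurable (S.timedStep h) :=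
  Measurable.lintegral_kernel_prod_right (κ := S.stepKernel.comap Prod.snd measurable_snd)
    (f := fun q w => h (q.1 + w.1, w.2)) (hh.comp (by fun_prop))

theorem timedStep_eq_lintegral_jumpMean (hh : Measurable h) (q : ℝ≥0 × (S.M × E)) :
    S.timedStep h q = ∫⁻ u, S.jumpMean h q u ∂S.waitingLaw := by
  have hf : Measurable fun w : ℝ≥0 × (S.M × E) => h (q.1 + w.1, w.2) := hh.comp (by fun_prop)
  rw [timedStep, stepKernel, Kernel.lintegral_comp _ _ _ hf,
    Kernel.lintegral_id_prod hf.lintegral_kernel, Kernel.const_apply]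
  refine lintegral_congr fun u => ?_
  change ∫⁻ w, h (q.1 + w.1, w.2) ∂S.jumpMeasure (q.2, u) = _
  simp [jumpMeasure, jumpMean, lintegral_dirac' _ hf]

theorem measurable_transitionProb (hG : MeasurableSet G) (n : ℕ) :
    Measurable (S.transitionProb n G) := by
  induction n with
  | zero => exact measurable_one.indicator hG
  | succ n ih => exact transitionProb_succ (S := S) n ▸ measurable_timedStep ih

theorem transitionProb_snd_preimage_eq (n : ℕ) (s s' : ℝ≥0) (z : S.M × E) :
    S.transitionProb n (Prod.snd ⁻¹' B) (s, z) = S.transitionProb n (Prod.snd ⁻¹' B) (s', z) := by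
  induction n generalizing s s' z with
  | zero => rfl
  | succ n ih =>
    simp only [transitionProb_succ]
    exact lintegral_congr fun w => ih (s + w.1) (s' + w.1) w.2

theorem CanReach.of_mem {q : ℝ≥0 × (S.M × E)} (hq : q ∈ G) : S.CanReach G q := by
  refine ⟨0, ?_⟩
  rw [transitionProb, Function.iterate_zero_apply, indicator_of_mem hq]
  exact one_pos

variable [TopologicalSpace E] [DiscreteTopology E]

theorem lowerSemicontinuous_timedStep (hh : LowerSemicontinuous h) :
    LowerSemicontinuous (S.timedStep h) := by
  rw [funext (timedStep_eq_lintegral_jumpMean hh.measurable)]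
  exact lowerSemicontinuous_lintegral S.waitingLaw
    (fun u => (lowerSemicontinuous_jumpMean hh).comp (g := fun q => (q, u)) (by fun_prop))
    fun q => ((lowerSemicontinuous_jumpMean hh).comp (g := fun u => (q, u))
      (by fun_prop)).measurable

theorem timedStep_pos (hh : LowerSemicontinuous h) {s u : ℝ≥0} {y : S.M} {i k : E}
    (hQ : 0 < S.Q (S.Phi i u y) i k) (hpos : 0 < h (s + u, (S.Phi i u y, k))) :
    0 < S.timedStep h (s, (y, i)) := by
  rw [timedStep_eq_lintegral_jumpMean hh.measurable]
  exact lintegral_pos_of_lowerSemicontinuous S.waitingLaw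
    ((lowerSemicontinuous_jumpMean hh).comp (g := fun u => ((s, (y, i)), u)) (by fun_prop))
    (jumpMean_pos hQ hpos)

theorem lowerSemicontinuous_transitionProb (hG : IsOpen G) (n : ℕ) :
    LowerSemicontinuous (S.transitionProb n G) := by
  induction n with
  | zero => exact hG.lowerSemicontinuous_indicator (y := (1 : ℝ≥0∞)) zero_le
  | succ n ih => exact transitionProb_succ (S := S) n ▸ lowerSemicontinuous_timedStep ih

theorem monotone_support_transitionProb (hG : IsOpen G) :
    Monotone fun n => Function.support (S.transitionProb n G) := by
  refine monotone_nat_of_le_succ fun n => ?_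
  rintro ⟨s, y, i⟩ hq
  rw [transitionProb_succ]
  refine (timedStep_pos (lowerSemicontinuous_transitionProb hG n) (u := 0)
    (S.Q_self_pos _ i) ?_).ne'
  rw [S.Phi_zero, add_zero]
  exact pos_iff_ne_zero.mpr hq

namespace CanReach

theorem of_step (hG : IsOpen G) {s u : ℝ≥0} {y : S.M} {i k : E}
    (hQ : 0 < S.Q (S.Phi i u y) i k) (hreach : S.CanReach G (s + u, (S.Phi i u y, k))) :
    S.CanReach G (s, (y, i)) := by
  obtain ⟨n, hn⟩ := hreach
  refine ⟨n + 1, ?_⟩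
  rw [transitionProb_succ]
  exact timedStep_pos (lowerSemicontinuous_transitionProb hG n) hQ hn

theorem of_mode (hG : IsOpen G) {s : ℝ≥0} {y : S.M} {j : E} (hreach : S.CanReach G (s, (y, j)))
    (i : E) : S.CanReach G (s, (y, i)) := by
  induction S.irreducible y i j using Relation.ReflTransGen.head_induction_on with
  | refl => exact hreach
  | @head a b hab _ ih =>
    refine of_step hG (u := 0) (k := b) ?_ ?_ <;> rw [S.Phi_zero]
    · exact S.Q_pos_of_rate_pos hab
    · rwa [add_zero]

theorem of_compositeFlow (hG : IsOpen G) {i : ℕ → E} {u : ℕ → ℝ≥0} {x : S.M} {n : ℕ} {j : E}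
    (hreach : S.CanReach G (∑ k ∈ Finset.range n, u (k + 1), (S.compositeFlow i u x n, j)))
    (a : E) : S.CanReach G (0, (x, a)) := by
  induction n generalizing j with
  | zero => exact hreach.of_mode hG a
  | succ n ih =>
    rw [Finset.sum_range_succ] at hreach
    exact ih (of_step hG (S.Q_self_pos _ _) (hreach.of_mode hG (i n)))

end CanReach

end TransitionOperator

section MarkovProperty

variable [MeasurableSpace E] [MeasurableSingletonClass E] {S} {x : S.M} {i : E}
  {G : Set (ℝ≥0 × (S.M × E))} {B : Set (S.M × E)} {A : Set S.Path} {n : ℕ}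

theorem setLIntegral_prob_succ (hA : MeasurableSet[Filtration.piLE n] A)
    {F : (ℝ≥0 × (S.M × E)) × (ℝ≥0 × (S.M × E)) → ℝ≥0∞} (hF : Measurable F) :
    ∫⁻ ω in A, F (S.timedChain n ω, ω (n + 1)) ∂S.prob x i =
      ∫⁻ ω in A, ∫⁻ w, F (S.timedChain n ω, w) ∂S.stepKernel (S.chain n ω) ∂S.prob x i := by
  have h := setLIntegral_trajMeasure_succ (X := fun _ => ℝ≥0 × (S.M × E))
    (μ₀ := Measure.dirac (0, (x, i))) (κ := S.historyKernel) hA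
    (F := fun p => F (S.historyTimedChain n p.1, p.2))
    (hF.comp (((S.measurable_historyTimedChain n).comp measurable_fst).prodMk measurable_snd))
  simp only [historyTimedChain_frestrictLe] at h
  exact h

theorem setLIntegral_timedChain_succ (hA : MeasurableSet[Filtration.piLE n] A)
    {f : ℝ≥0 × (S.M × E) → ℝ≥0∞} (hf : Measurable f) :
    ∫⁻ ω in A, f (S.timedChain (n + 1) ω) ∂S.prob x i =
      ∫⁻ ω in A, S.timedStep f (S.timedChain n ω) ∂S.prob x i := by
  have h := setLIntegral_prob_succ (x := x) (i := i) hA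
    (F := fun p => f (p.1.1 + p.2.1, p.2.2)) (hf.comp (by fun_prop))
  simp only [timedChain, jumpTime_succ]
  exact h

theorem prob_inter_timedChain_mem (hA : MeasurableSet[Filtration.piLE n] A)
    (hG : MeasurableSet G) (m : ℕ) :
    S.prob x i (A ∩ S.timedChain (n + m) ⁻¹' G) =
      ∫⁻ ω in A, S.transitionProb m G (S.timedChain n ω) ∂S.prob x i := by
  induction m generalizing n with
  | zero =>
    have hmeas : MeasurableSet (S.timedChain n ⁻¹' G) :=
      Filtration.piLE.le n _ (S.measurable_timedChain_piLE n hG)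
    rw [Nat.add_zero, inter_comm, ← Measure.restrict_apply hmeas,
      ← lintegral_indicator_one hmeas]
    rfl
  | succ m ih =>
    rw [transitionProb_succ, ← setLIntegral_timedChain_succ hA (measurable_transitionProb hG m),
      ← ih (Filtration.piLE.mono (Nat.le_add_right n 1) _ hA), Nat.add_right_comm, Nat.add_assoc]

theorem ae_timedChain_zero_eq : ∀ᵐ ω ∂S.prob x i, S.timedChain 0 ω = (0, (x, i)) := by
  have hstart : (S.prob x i).map (fun ω => ω 0) = Measure.dirac (0, (x, i)) :=
    map_eval_zero_trajMeasure
  have hmem : ∀ᵐ w ∂(S.prob x i).map (fun ω => ω 0), w.2 ∈ ({(x, i)} : Set (S.M × E)) := by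
    rw [hstart, ae_dirac_iff (measurable_snd (measurableSet_singleton _))]
    exact mem_singleton _
  filter_upwards [ae_of_ae_map (measurable_pi_apply 0).aemeasurable hmem] with ω hω
  exact Prod.ext (Finset.sum_range_zero fun k => (ω (k + 1)).1) hω

theorem prob_timedChain_mem (hG : MeasurableSet G) (m : ℕ) :
    S.prob x i (S.timedChain m ⁻¹' G) = S.transitionProb m G (0, (x, i)) := by
  have h := prob_inter_timedChain_mem (x := x) (i := i) (n := 0) .univ hG m
  rw [univ_inter, Nat.zero_add, Measure.restrict_univ] at h
  rw [h, lintegral_congr_ae (ae_timedChain_zero_eq.mono fun ω hω =>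
    congrArg (S.transitionProb m G) hω), lintegral_const, measure_univ, mul_one]

theorem transitionProb_snd_preimage (hB : MeasurableSet B) (m : ℕ) (s : ℝ≥0) (z : S.M × E) :
    S.transitionProb m (Prod.snd ⁻¹' B) (s, z) = S.prob z.1 z.2 (S.chain m ⁻¹' B) := by
  rw [transitionProb_snd_preimage_eq m s 0 z]
  exact (prob_timedChain_mem (measurable_snd hB) m).symm

theorem prob_inter_chain_mem (hA : MeasurableSet[Filtration.piLE n] A) (hB : MeasurableSet B)
    (m : ℕ) : S.prob x i (A ∩ S.chain (n + m) ⁻¹' B) =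
      ∫⁻ ω in A, S.prob (S.chain n ω).1 (S.chain n ω).2 (S.chain m ⁻¹' B) ∂S.prob x i :=
  (prob_inter_timedChain_mem hA (measurable_snd hB) m).trans
    (lintegral_congr fun _ => transitionProb_snd_preimage hB m _ _)

theorem mul_le_prob_inter_chain_mem {m : ℕ} {ε : ℝ≥0∞} (hB : MeasurableSet B)
    (hε : ∀ y k, ε ≤ S.prob y k (S.chain m ⁻¹' B)) (hA : MeasurableSet[Filtration.piLE n] A) :
    ε * S.prob x i A ≤ S.prob x i (A ∩ S.chain (n + m) ⁻¹' B) :=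
  calc ε * S.prob x i A
    _ = ∫⁻ _ in A, ε ∂S.prob x i := (setLIntegral_const A ε).symm
    _ ≤ ∫⁻ ω in A, S.prob (S.chain n ω).1 (S.chain n ω).2 (S.chain m ⁻¹' B) ∂S.prob x i :=
        lintegral_mono fun _ => hε _ _
    _ = S.prob x i (A ∩ S.chain (n + m) ⁻¹' B) := (prob_inter_chain_mem hA hB m).symm

theorem ae_exists_chain_mem {m : ℕ} {ε : ℝ≥0∞} (hB : MeasurableSet B) (hε₀ : 0 < ε)
    (hε : ∀ y k, ε ≤ S.prob y k (S.chain m ⁻¹' B)) :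
    ∀ᵐ ω ∂S.prob x i, ∃ l, S.chain l ω ∈ B := by
  let miss (k : ℕ) : Set S.Path := {ω | ∀ l ≤ k * m, S.chain l ω ∉ B}
  have hmiss_succ : ∀ k, S.prob x i (miss (k + 1)) ≤ (1 - ε) * S.prob x i (miss k) := fun k => by
    have hhit := mul_le_prob_inter_chain_mem (x := x) (i := i) hB hε
      (S.measurableSet_piLE_forall_le_chain_notMem hB (k * m))
    have hsub : miss (k + 1) ⊆ miss k \ S.chain (k * m + m) ⁻¹' B := fun ω hω =>
      ⟨fun l hl => hω l (hl.trans (Nat.mul_le_mul_right m k.le_succ)),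
        hω _ (Nat.succ_mul k m).ge⟩
    rw [ENNReal.sub_mul fun _ _ => measure_ne_top _ _, one_mul]
    refine ENNReal.le_sub_of_add_le_left (ne_top_of_le_ne_top (measure_ne_top _ _) hhit) ?_
    calc ε * S.prob x i (miss k) + S.prob x i (miss (k + 1))
      _ ≤ S.prob x i (miss k ∩ S.chain (k * m + m) ⁻¹' B) +
          S.prob x i (miss k \ S.chain (k * m + m) ⁻¹' B) :=
        add_le_add hhit (measure_mono hsub)
      _ = S.prob x i (miss k) := measure_inter_add_sdiff _
        (Filtration.piLE.le _ _ (S.measurable_chain_piLE _ hB))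
  rw [ae_iff]
  refine measure_mono_null (fun ω hω => ?_) (measure_iInter_eq_zero_of_le_mul
    (measure_ne_top _ _) (ENNReal.sub_lt_self ENNReal.one_ne_top one_ne_zero hε₀.ne') hmiss_succ)
  exact mem_iInter.mpr fun k l _ hl => hω ⟨l, hl⟩

theorem stepKernel_fst_preimage (z : S.M × E) {C : Set ℝ≥0} (hC : MeasurableSet C) :
    S.stepKernel z (Prod.fst ⁻¹' C) = S.waitingLaw C := by
  rw [S.stepKernel_apply z (measurable_fst hC), ← lintegral_indicator_one hC]
  refine lintegral_congr fun u => ?_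
  calc ∑ j, ENNReal.ofReal (S.Q (S.Phi z.2 u z.1) z.2 j) *
        (Prod.fst ⁻¹' C).indicator 1 (u, (S.Phi z.2 u z.1, j))
    _ = (∑ j, ENNReal.ofReal (S.Q (S.Phi z.2 u z.1) z.2 j)) * C.indicator 1 u :=
        (Finset.sum_mul Finset.univ _ (C.indicator 1 u)).symm
    _ = C.indicator 1 u := by
        rw [← ENNReal.ofReal_sum_of_nonneg fun _ _ => S.Q_nonneg _ _ _, S.sum_Q,
          ENNReal.ofReal_one, one_mul]

theorem prob_inter_waiting_mem (hA : MeasurableSet[Filtration.piLE n] A) {C : Set ℝ≥0}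
    (hC : MeasurableSet C) :
    S.prob x i (A ∩ {ω | (ω (n + 1)).1 ∈ C}) = S.prob x i A * S.waitingLaw C := by
  have hmeas : MeasurableSet {ω : S.Path | (ω (n + 1)).1 ∈ C} :=
    (measurable_fst.comp (measurable_pi_apply (n + 1))) hC
  have hC' : MeasurableSet (Prod.fst ⁻¹' C : Set (ℝ≥0 × (S.M × E))) := measurable_fst hC
  have h := setLIntegral_prob_succ (x := x) (i := i) hA
    (F := fun p => (Prod.fst ⁻¹' C).indicator 1 p.2)
    ((measurable_one.indicator hC').comp measurable_snd)
  simp only [lintegral_indicator_one hC', stepKernel_fst_preimage _ hC, setLIntegral_const] at h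
  rw [inter_comm, ← Measure.restrict_apply hmeas, ← lintegral_indicator_one hmeas, mul_comm, ← h]
  rfl

theorem transitionProb_flowInto_mul_le {t : ℝ≥0} (hG : MeasurableSet (S.flowInto t B))
    (n : ℕ) :
    S.transitionProb n (S.flowInto t B) (0, (x, i)) * S.waitingLaw (Ioi t) ≤
      S.prob x i {ω | S.process t ω ∈ B} := by
  rw [← prob_timedChain_mem hG n,
    ← prob_inter_waiting_mem (S.measurable_timedChain_piLE n hG) measurableSet_Ioi]
  exact measure_mono fun ω hω => S.process_mem_of_timedChain_mem_flowInto hω.1 hω.2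

end MarkovProperty

section AccessiblePoints

variable [TopologicalSpace E] [DiscreteTopology E] [MeasurableSpace E] [MeasurableSingletonClass E]
  {S} {p : S.M} {V : Set S.M}

theorem canReach_snd_preimage_prod (hp : p ∈ S.accessibleSet) (hV : IsOpen V) (hpV : p ∈ V)
    (x : S.M) (i j : E) : S.CanReach (Prod.snd ⁻¹' (V ×ˢ {j})) (0, (x, i)) := by
  obtain ⟨n, a, u, hn⟩ := S.exists_compositeFlow_mem hp hV hpV x
  refine CanReach.of_compositeFlow (i := a) (u := u) (n := n) (j := j)
    ((hV.prod (isOpen_discrete {j})).preimage continuous_snd) (.of_mem ?_) i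
  exact ⟨hn, mem_singleton j⟩

theorem exists_forall_le_prob_chain_mem (hp : p ∈ S.accessibleSet) (hV : IsOpen V) (hpV : p ∈ V) :
    ∃ (m : ℕ) (ε : ℝ≥0), 0 < ε ∧
      ∀ (x : S.M) (i j : E), ε ≤ S.prob x i {ω | S.chain m ω ∈ V ×ˢ {j}} := by
  have hopen : ∀ j : E, IsOpen (V ×ˢ {j}) := fun j => hV.prod (isOpen_discrete {j})
  let f (n : ℕ) (r : E × (S.M × E)) : ℝ≥0∞ :=
    S.transitionProb n (Prod.snd ⁻¹' (V ×ˢ {r.1})) (0, r.2)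
  have hlsc : ∀ n, LowerSemicontinuous (f n) := fun n =>
    lowerSemicontinuous_prod_of_discrete_left fun j =>
      (lowerSemicontinuous_transitionProb ((hopen j).preimage continuous_snd) n).comp
        (g := fun z => (0, z)) (by fun_prop)
  have hmono : Monotone fun n => Function.support (f n) := fun _ _ hnm r hr =>
    monotone_support_transitionProb ((hopen r.1).preimage continuous_snd) hnm hr
  obtain ⟨m, hm⟩ := exists_forall_pos_of_monotone_support hlsc hmono fun r =>
    canReach_snd_preimage_prod hp hV hpV r.2.1 r.2.2 r.1
  obtain ⟨ε, hε, hεf⟩ := exists_pos_forall_lt_of_lowerSemicontinuous (hlsc m) hm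
  refine ⟨m, ε, hε, fun x i j => (hεf (j, (x, i))).le.trans_eq ?_⟩
  exact transitionProb_snd_preimage (hopen j).measurableSet m 0 (x, i)

theorem exists_time_forall_canReach_flowInto (hp : p ∈ S.accessibleSet) (hV : IsOpen V)
    (hpV : p ∈ V) (x : S.M) :
    ∃ t, 0 < t ∧ ∀ i j : E, S.CanReach (S.flowInto t (V ×ˢ {j})) (0, (x, i)) := by
  obtain ⟨n, a, u, hn⟩ := S.exists_compositeFlow_mem hp hV hpV x
  have hstay : ∀ᶠ η : ℝ≥0 in 𝓝[>] 0, ∀ j, S.Phi j η (S.compositeFlow a u x n) ∈ V :=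
    Filter.eventually_all.mpr fun j => by
      have hc : Continuous fun η => S.Phi j η (S.compositeFlow a u x n) :=
        (S.continuous_Phi j).comp (by fun_prop : Continuous fun η => (η, S.compositeFlow a u x n))
      exact mem_nhdsWithin_of_mem_nhds
        ((hV.preimage hc).mem_nhds (by rwa [mem_preimage, S.Phi_zero]))
  obtain ⟨η, hηV, hη⟩ := (hstay.and self_mem_nhdsWithin).exists
  refine ⟨∑ k ∈ Finset.range n, u (k + 1) + η, hη.trans_le le_add_self, fun i j => ?_⟩
  refine CanReach.of_compositeFlow (i := a) (u := u) (n := n) (j := j)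
    (S.isOpen_flowInto _ (hV.prod (isOpen_discrete {j})))
    (.of_mem ⟨lt_add_of_pos_right _ hη, ?_, mem_singleton j⟩) i
  rw [add_tsub_cancel_left]
  exact hηV j

theorem exists_time_eventually_le_prob_process (hp : p ∈ S.accessibleSet) (hV : IsOpen V)
    (hpV : p ∈ V) (x : S.M) :
    ∃ (t : ℝ≥0) (ε : ℝ≥0∞), 0 < t ∧ 0 < ε ∧
      ∀ᶠ y in 𝓝 x, ∀ i j : E, ε ≤ S.prob y i {ω | S.process t ω ∈ V ×ˢ {j}} := by
  obtain ⟨t, ht, hreach⟩ := exists_time_forall_canReach_flowInto hp hV hpV x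
  choose n hn using hreach
  have hopen : ∀ j, IsOpen (S.flowInto t (V ×ˢ {j})) := fun j =>
    S.isOpen_flowInto t (hV.prod (isOpen_discrete {j}))
  obtain ⟨ε, hε, hεn⟩ := exists_pos_forall_lt_of_lowerSemicontinuous
    (f := fun b : E × E => S.transitionProb (n b.1 b.2) (S.flowInto t (V ×ˢ {b.2})) (0, (x, b.1)))
    continuous_of_discreteTopology.lowerSemicontinuous fun b => hn b.1 b.2
  have hnear : ∀ᶠ y in 𝓝 x, ∀ i j,
      ε < S.transitionProb (n i j) (S.flowInto t (V ×ˢ {j})) (0, (y, i)) :=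
    Filter.eventually_all.mpr fun i => Filter.eventually_all.mpr fun j =>
      (lowerSemicontinuous_transitionProb (hopen j) (n i j)).comp
        (g := fun y => (0, (y, i))) (by fun_prop) x ε (hεn (i, j))
  refine ⟨t, ε * S.waitingLaw (Ioi t), ht, ENNReal.mul_pos (ENNReal.coe_pos.mpr hε).ne'
    (isOpen_Ioi.measure_pos S.waitingLaw nonempty_Ioi).ne', hnear.mono fun y hy i j => ?_⟩
  calc ε * S.waitingLaw (Ioi t)
    _ ≤ S.transitionProb (n i j) (S.flowInto t (V ×ˢ {j})) (0, (y, i)) * S.waitingLaw (Ioi t) :=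
        mul_le_mul_left (hy i j).le _
    _ ≤ S.prob y i {ω | S.process t ω ∈ V ×ˢ {j}} :=
        transitionProb_flowInto_mul_le (hopen j).measurableSet _

theorem exists_cover_forall_le_prob_process (hp : p ∈ S.accessibleSet) (hV : IsOpen V)
    (hpV : p ∈ V) :
    ∃ (N : ℕ) (O : Fin N → Set S.M) (t : Fin N → ℝ≥0) (ε : ℝ≥0),
      (∀ k, IsOpen (O k)) ∧ (⋃ k, O k) = univ ∧ (∀ k, 0 < t k) ∧ 0 < ε ∧
      ∀ (i j : E) (k : Fin N), ∀ x ∈ O k,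
        ε ≤ S.prob x i {ω | S.process (t k) ω ∈ V ×ˢ {j}} := by
  choose t ε ht hε hnear using exists_time_eventually_le_prob_process hp hV hpV
  obtain ⟨N, c, hc⟩ := exists_fin_iUnion_interior_eq_univ _ hnear
  obtain ⟨δ, hδ, hδε⟩ := exists_pos_forall_lt_of_lowerSemicontinuous (f := fun k => ε (c k))
    continuous_of_discreteTopology.lowerSemicontinuous fun k => hε (c k)
  exact ⟨N, _, fun k => t (c k), δ, fun _ => isOpen_interior, hc, fun k => ht (c k), hδ,
    fun i j k x hx => (hδε k).le.trans (interior_subset hx i j)⟩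

end AccessiblePoints

end System

end SwitchedFlow

theorem mainTheorem10 {d : ℕ} {E : Type*} [Fintype E] [MeasurableSpace E]
    [MeasurableSingletonClass E] (S : SwitchedFlow.System d E)
    (p : S.M) (hp : p ∈ S.accessibleSet) (U : Set S.M) (hU : U ∈ 𝓝 p) :
    (∃ (m : ℕ) (δ : ℝ), 0 < δ ∧ ∀ (x : S.M) (i j : E),
      δ ≤ (S.prob x i).real {ω | S.chain m ω ∈ U ×ˢ {j}}) ∧
    (∀ (x : S.M) (i j : E), ∀ᵐ ω ∂(S.prob x i), ∃ l : ℕ, S.chain l ω ∈ U ×ˢ {j}) ∧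
    (∃ (N : ℕ) (O : Fin N → Set S.M) (t : Fin N → ℝ≥0) (δ : ℝ),
      (∀ k, IsOpen (O k)) ∧ (⋃ k, O k) = univ ∧ (∀ k, 0 < t k) ∧ 0 < δ ∧
      ∀ (i j : E) (k : Fin N), ∀ x ∈ O k,
        δ ≤ (S.prob x i).real {ω | S.process (t k) ω ∈ U ×ˢ {j}}) := by
  let : TopologicalSpace E := ⊥
  have : DiscreteTopology E := ⟨rfl⟩
  have hV : IsOpen (interior U) := isOpen_interior
  have hpV : p ∈ interior U := mem_interior_iff_mem_nhds.mpr hU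
  have hsub : ∀ j : E, interior U ×ˢ {j} ⊆ U ×ˢ {j} := fun _ => prod_mono_left interior_subset
  obtain ⟨m, ε, hε, hchain⟩ := SwitchedFlow.System.exists_forall_le_prob_chain_mem hp hV hpV
  obtain ⟨N, O, t, δ, hO, hcover, ht, hδ, hprocess⟩ :=
    SwitchedFlow.System.exists_cover_forall_le_prob_process hp hV hpV
  refine ⟨⟨m, ε, hε, fun x i j => ?_⟩, fun x i j => ?_,
    ⟨N, O, t, δ, hO, hcover, ht, hδ, fun i j k x hx => ?_⟩⟩
  · exact ENNReal.toReal_mono (measure_ne_top _ _)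
      ((hchain x i j).trans (measure_mono fun _ hω => hsub j hω))
  · have hhit := SwitchedFlow.System.ae_exists_chain_mem (x := x) (i := i)
      (hV.measurableSet.prod (measurableSet_singleton j)) (ENNReal.coe_pos.mpr hε)
      fun y k => hchain y k j
    exact hhit.mono fun _ hω => hω.imp fun _ hl => hsub j hl
  · exact ENNReal.toReal_mono (measure_ne_top _ _)
      ((hprocess i j k x hx).trans (measure_mono fun _ hω => hsub j hω))
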